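/- Let $\mathcal G$ be a connected simple undirected graph with vertex set $\{0,\dots,N-1\}$, $N\ge 1$, Laplacian matrix $L$ (degree matrix minus adjacency matrix), and Laplacian eigenvalues $0=\lambda_0<\lambda_1\le\dots\le\lambda_{N-1}$, listed with multiplicity. Let $L^\dagger$ be the Moore--Penrose pseudo-inverse of $L$. The biharmonic distance $d_B(j,k)\ge 0$ between vertices $j,k$ is given by $$d_B^2(j,k)=\big((L^{\dagger})^2\big)_{jj}+\big((L^{\dagger})^2\big)_{kk}-2\big((L^{\dagger})^2\big)_{jk},$$ and the biharmonic Kirchhoff index of $\mathcal G$ is $D_B^2(\mathcal G)=\sum_{j<k}d_B^2(j,k)$. Consider the noisy second-order consensus dynamics $$\begin{bmatrix}\dot x_1(t)\\ \dot x_2(t)\end{bmatrix}=\begin{bmatrix}0&I\\-L&-L\end{bmatrix}\begin{bmatrix}x_1(t)\\x_2(t)\end{bmatrix}+\begin{bmatrix}0\\I\end{bmatrix}w(t),\qquad t\ge 0,$$ where $x_1(t),x_2(t)\in\mathbb R^N$ and $w$ is a vector of $N$ independent unit-intensity Gaussian white noise processes (that is, $w=\dot W$ for a standard $N$-dimensional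 Brownian motion $W$, the equation being understood in integrated form), and where the initial state $(x_1(0),x_2(0))$ is random with finite second moments. Let $\bar x_1(t)=\frac1N\sum_{j}x_{1j}(t)$. Then for every solution the expectations below are finite, the limit $$H_{\mathrm{SO}}(\mathcal G)=\lim_{t\to\infty}\sum_{j=0}^{N-1}\mathbb E\big[(x_{1j}(t)-\bar x_1(t))^2\big]$$ (the total steady-state variance) exists, and $$H_{\mathrm{SO}}(\mathcal G)=\frac{1}{2N}\,D_B^2(\mathcal G)=\frac12\sum_{i=1}^{N-1}\frac{1}{\lambda_i^2}.$$ -/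

import Mathlib

open MeasureTheory ProbabilityTheory Filter Matrix
open scoped NNReal Topology

namespace SecondOrderConsensus

section Graph

variable {N : ℕ} (G : SimpleGraph (Fin N)) [DecidableRel G.Adj]

/-- The eigenvalues of the Laplacian `L = D - A` in nondecreasing order, with multiplicity.
(Mathlib lists the eigenvalues of a Hermitian matrix in nonincreasing order.) -/
noncomputable def lapEigenvalue (i : Fin N) : ℝ :=
  (G.isHermitian_lapMatrix ℝ).eigenvalues₀ (Fin.cast (Fintype.card_fin N).symm i.rev)

/-- The defining (Penrose) equations of the pseudo-inverse of a real square matrix. -/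
structure IsPseudoInverse (A B : Matrix (Fin N) (Fin N) ℝ) : Prop where
  mul_mul_left : A * B * A = A
  mul_mul_right : B * A * B = B
  symm_left : (A * B)ᵀ = A * B
  symm_right : (B * A)ᵀ = B * A

/-- The pseudo-inverse `L†` of the Laplacian: in an orthonormal eigenbasis of `L`, nonzero
eigenvalues are inverted and zero is kept (`0⁻¹ = 0`). -/
noncomputable def lapPseudoInverse : Matrix (Fin N) (Fin N) ℝ :=
  ((G.isHermitian_lapMatrix ℝ).eigenvectorUnitary : Matrix (Fin N) (Fin N) ℝ) *
    diagonal (fun i => ((G.isHermitian_lapMatrix ℝ).eigenvalues i)⁻¹) *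
    ((G.isHermitian_lapMatrix ℝ).eigenvectorUnitary : Matrix (Fin N) (Fin N) ℝ)ᵀ

/-- `lapPseudoInverse` satisfies the Penrose equations, so it is the (unique) pseudo-inverse. -/
theorem isPseudoInverse_lapPseudoInverse :
    IsPseudoInverse (G.lapMatrix ℝ) (lapPseudoInverse G) := by
  have hL := (G.isHermitian_lapMatrix ℝ).spectral_theorem
  have hU : ((G.isHermitian_lapMatrix ℝ).eigenvectorUnitary : Matrix (Fin N) (Fin N) ℝ)ᵀ *
      ((G.isHermitian_lapMatrix ℝ).eigenvectorUnitary : Matrix (Fin N) (Fin N) ℝ) = 1 :=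
    Unitary.coe_star_mul_self (G.isHermitian_lapMatrix ℝ).eigenvectorUnitary
  rw [Unitary.conjStarAlgAut_apply] at hL
  unfold lapPseudoInverse
  set U : Matrix (Fin N) (Fin N) ℝ :=
    ((G.isHermitian_lapMatrix ℝ).eigenvectorUnitary : Matrix (Fin N) (Fin N) ℝ)
  set v := (G.isHermitian_lapMatrix ℝ).eigenvalues
  have hL' : G.lapMatrix ℝ = U * diagonal v * Uᵀ := hL
  have key : ∀ a b : Fin N → ℝ, (U * diagonal a * Uᵀ) * (U * diagonal b * Uᵀ) =
      U * diagonal (fun i => a i * b i) * Uᵀ := by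
    intro a b
    calc (U * diagonal a * Uᵀ) * (U * diagonal b * Uᵀ)
        = U * diagonal a * (Uᵀ * U) * diagonal b * Uᵀ := by simp only [Matrix.mul_assoc]
      _ = _ := by rw [hU, Matrix.mul_one, Matrix.mul_assoc U, diagonal_mul_diagonal]
  have hsymm : ∀ a : Fin N → ℝ, (U * diagonal a * Uᵀ)ᵀ = U * diagonal a * Uᵀ := by
    intro a
    simp [Matrix.transpose_mul, Matrix.mul_assoc]
  rw [hL']
  refine ⟨?_, ?_, ?_, ?_⟩
  · rw [key, key]; congr 3; ext i; by_cases h : v i = 0 <;> simp [h]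
  · rw [key, key]; congr 3; ext i; by_cases h : v i = 0 <;> simp [h]
  · rw [key, hsymm]
  · rw [key, hsymm]

/-- The biharmonic distance `d_B(j, k)`, whose square is
`(L†)²_{jj} + (L†)²_{kk} - 2 (L†)²_{jk}`. -/
noncomputable def biharmonicDist (j k : Fin N) : ℝ :=
  Real.sqrt ((lapPseudoInverse G ^ 2) j j + (lapPseudoInverse G ^ 2) k k
    - 2 * (lapPseudoInverse G ^ 2) j k)

/-- The biharmonic Kirchhoff index `D_B²(G)`: the sum of `d_B(j, k)²` over pairs `j < k`. -/
noncomputable def biharmonicKirchhoffIndex : ℝ :=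
  ∑ p : Fin N × Fin N with p.1 < p.2, biharmonicDist G p.1 p.2 ^ 2

/-- The system matrix with rows `[0, I]` and `[-L, -L]`. -/
noncomputable def systemMatrix : Matrix (Fin N ⊕ Fin N) (Fin N ⊕ Fin N) ℝ :=
  Matrix.fromBlocks 0 1 (-G.lapMatrix ℝ) (-G.lapMatrix ℝ)

end Graph

/-- The input matrix with rows `0` and `I`. -/
def inputMatrix (N : ℕ) : Matrix (Fin N ⊕ Fin N) (Fin N) ℝ :=
  Matrix.fromRows 0 1

section Dynamics

variable {N : ℕ} {Ω : Type*} [MeasurableSpace Ω]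

/-- A standard `N`-dimensional Brownian motion: the coordinates are independent standard real
Brownian motions. Its formal derivative is a vector of uncorrelated unit Gaussian white noises. -/
structure IsStandardBrownianMotion (W : ℝ≥0 → Ω → Fin N → ℝ) (P : Measure Ω) : Prop where
  isBrownianReal : ∀ j, IsBrownianReal (fun t ω => W t ω j) P
  iIndepFun : iIndepFun (fun (j : Fin N) (ω : Ω) (t : ℝ≥0) => W t ω j) P

/-- `x = (x₁, x₂)` solves `ẋ = A x + B w` with `A = systemMatrix G`, `B = inputMatrix N` and
`w = Ẇ`. As the noise is additive, this is the pathwise integral equation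
`x(t) = x(0) + ∫₀ᵗ A x(s) ds + B W(t)` for a process with continuous paths. The entries
`Sum.inl j` and `Sum.inr j` of the state are those of `x₁` and `x₂` at the vertex `j`. -/
structure IsSolution (G : SimpleGraph (Fin N)) [DecidableRel G.Adj]
    (W : ℝ≥0 → Ω → Fin N → ℝ) (x : ℝ≥0 → Ω → Fin N ⊕ Fin N → ℝ) (P : Measure Ω) : Prop where
  aemeasurable : ∀ t, AEMeasurable (x t) P
  continuous_path : ∀ᵐ ω ∂P, Continuous fun t => x t ω
  integral_eq : ∀ᵐ ω ∂P, ∀ t : ℝ≥0,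
    x t ω = x 0 ω + (∫ s in (0 : ℝ)..t, systemMatrix G *ᵥ x s.toNNReal ω)
      + inputMatrix N *ᵥ W t ω

/-- The deviation of `x₁` at the vertex `j` from the current average of `x₁`. -/
noncomputable def deviation (x : ℝ≥0 → Ω → Fin N ⊕ Fin N → ℝ) (j : Fin N) (t : ℝ≥0) (ω : Ω) : ℝ :=
  x t ω (Sum.inl j) - (1 / (N : ℝ)) * ∑ k : Fin N, x t ω (Sum.inl k)

end Dynamics

/-- `h` is the total steady-state variance: the deviations have finite second moments, and
`∑ⱼ 𝔼[deviation²]` tends to `h` as `t → ∞`. -/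
def HasTotalVariance {N : ℕ} {Ω : Type*} [MeasurableSpace Ω]
    (x : ℝ≥0 → Ω → Fin N ⊕ Fin N → ℝ) (P : Measure Ω) (h : ℝ) : Prop :=
  (∀ t j, Integrable (fun ω => deviation x j t ω ^ 2) P) ∧
    Tendsto (fun t : ℝ≥0 => ∑ j : Fin N, ∫ ω, deviation x j t ω ^ 2 ∂P) atTop (𝓝 h)

end SecondOrderConsensus

/-! The dynamics decouple in an orthonormal eigenbasis of the Laplacian. The mode with eigenvalue
`c` is a scalar damped oscillator `y' = z`, `z' = -c y - c z + ḃ`, where `b` is the projection of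
the noise on a unit vector and so has covariance `min s t`. Connectedness makes the kernel of `L`
the constants, so subtracting the average removes exactly the zero modes. By Parseval the total
variance is then the sum of `𝔼 y²` over the nonzero modes; no independence between modes is needed.

Let `g` be the impulse response and `p = g'`. Formally `y` is a decaying free response plus `∫ g(t -
s) db(s)`; integrating by parts turns the latter into the pathwise integral `∫ p(t - s) b(s) ds`, so
no stochastic integral appears. Fubini and two integrations by parts against `min s r` give it the
second moment `∫₀ᵗ g²` (`memLp_and_integral_sq`, `integral_integral_snd_mul_min`), which tends to `1
/ (2 c²)`.

On the graph side, with `M = (L†)²`, summing `M j j + M k k - 2 M j k` over pairs gives `N tr M`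
minus the sum of all entries of `M`. That sum vanishes because `L†` kills constants, and `tr M = ∑
λ⁻²`. -/

namespace SecondOrderConsensus

/-! ### The scalar damped oscillator -/

/-- `g` is the impulse response of the oscillator `g'' + c g' + c g = 0` and `p` its derivative. -/
structure IsImpulseResponse (c : ℝ) (g p : ℝ → ℝ) : Prop where
  hasDerivAt_fst : ∀ t, HasDerivAt g (p t) t
  hasDerivAt_snd : ∀ t, HasDerivAt p (-(c * g t) - c * p t) t
  fst_zero : g 0 = 0
  snd_zero : p 0 = 1

/-- Taking the operator exponential avoids splitting into under-, critically and overdamped cases.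
-/
theorem exists_isImpulseResponse (c : ℝ) : ∃ g p : ℝ → ℝ, IsImpulseResponse c g p := by
  let A : (ℝ × ℝ) →L[ℝ] (ℝ × ℝ) :=
    (ContinuousLinearMap.snd ℝ ℝ ℝ).prod
      (-(c • ContinuousLinearMap.fst ℝ ℝ ℝ) - c • ContinuousLinearMap.snd ℝ ℝ ℝ)
  let φ : ℝ → ℝ × ℝ := fun t => NormedSpace.exp (t • A) (0, 1)
  have hφ : ∀ t, HasDerivAt φ (A (φ t)) t := by
    intro t
    have h := hasDerivAt_exp_smul_const' (𝕂 := ℝ) A t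
    exact h.clm_apply (hasDerivAt_const t ((0 : ℝ), (1 : ℝ))) |>.congr_deriv (by simp [φ])
  refine ⟨fun t => (φ t).1, fun t => (φ t).2, fun t => ?_, fun t => ?_, ?_, ?_⟩
  · exact (ContinuousLinearMap.fst ℝ ℝ ℝ).hasFDerivAt.comp_hasDerivAt t (hφ t)
  · exact (ContinuousLinearMap.snd ℝ ℝ ℝ).hasFDerivAt.comp_hasDerivAt t (hφ t)
  · simp [φ]
  · simp [φ]

namespace IsImpulseResponse

variable {c : ℝ} {g p : ℝ → ℝ}

theorem continuous_fst (h : IsImpulseResponse c g p) : Continuous g :=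
  continuous_iff_continuousAt.2 fun t => (h.hasDerivAt_fst t).continuousAt

theorem continuous_snd (h : IsImpulseResponse c g p) : Continuous p :=
  continuous_iff_continuousAt.2 fun t => (h.hasDerivAt_snd t).continuousAt

theorem tendsto_sq_add_sq (h : IsImpulseResponse c g p) (hc : 0 < c) :
    Tendsto (fun t => g t ^ 2 + p t ^ 2) atTop (𝓝 0) := by
  -- Lyapunov function. The energy `g² + p²/c` alone dissipates only `2 p²`; the cross term `g p`
  -- adds the missing `c g²`, and `c/2 g²` cancels the `c g p` it creates.
  let V : ℝ → ℝ := fun t => g t ^ 2 + p t ^ 2 / c + g t * p t + c / 2 * g t ^ 2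
  have hV : ∀ t, HasDerivAt V (-(p t ^ 2) - c * g t ^ 2) t := by
    intro t
    have h1 := h.hasDerivAt_fst t
    have h2 := h.hasDerivAt_snd t
    refine (((h1.pow 2).add ((h2.pow 2).div_const c)).add (h1.mul h2)).add
      ((h1.pow 2).const_mul (c / 2)) |>.congr_deriv ?_
    field_simp
    push_cast
    ring
  have hlow : ∀ t, min 1 (1 / (2 * c)) * (g t ^ 2 + p t ^ 2) ≤ V t := by
    intro t
    have h1 : min 1 (1 / (2 * c)) * g t ^ 2 ≤ 1 * g t ^ 2 := by gcongr; exact min_le_left _ _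
    have h2 : min 1 (1 / (2 * c)) * p t ^ 2 ≤ 1 / (2 * c) * p t ^ 2 := by
      gcongr; exact min_le_right _ _
    have h3 : V t - (1 * g t ^ 2 + 1 / (2 * c) * p t ^ 2) = (c * g t + p t) ^ 2 / (2 * c) := by
      simp only [V]; field_simp; ring
    have h4 : 0 ≤ (c * g t + p t) ^ 2 / (2 * c) := by positivity
    linarith
  set K : ℝ := 1 + 1 / c + 1 + c with hK
  have hKpos : 0 < K := by positivity
  have hup : ∀ t, V t ≤ K * (g t ^ 2 + p t ^ 2) := by
    intro t
    have h3 : K * (g t ^ 2 + p t ^ 2) - V t = (p t ^ 2 + g t ^ 2 / c + (c / 2) * g t ^ 2 + c * p t ^ 2)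
        + (g t ^ 2 + p t ^ 2 - g t * p t) := by
      simp only [V, hK]; field_simp; ring
    have h4 : 0 ≤ g t ^ 2 + p t ^ 2 - g t * p t := by nlinarith [sq_nonneg (g t - p t)]
    have h5 : 0 ≤ p t ^ 2 + g t ^ 2 / c + (c / 2) * g t ^ 2 + c * p t ^ 2 := by positivity
    linarith
  set m : ℝ := min 1 c with hm
  have hmpos : 0 < m := lt_min one_pos hc
  -- `V' ≤ -m (g² + p²) ≤ -(m / K) V`, hence exponential decay.
  have hdec : Antitone fun t => Real.exp (m / K * t) * V t := by
    refine antitone_of_hasDerivAt_nonpos (f' := fun t => Real.exp (m / K * t) * (m / K * V t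
      + (-(p t ^ 2) - c * g t ^ 2))) (fun t => ?_) (fun t => ?_)
    · refine ((((hasDerivAt_id t).const_mul (m / K)).exp).mul (hV t)).congr_deriv ?_
      simp; ring
    · refine mul_nonpos_of_nonneg_of_nonpos (Real.exp_pos _).le ?_
      have h1 : m / K * V t ≤ m * (g t ^ 2 + p t ^ 2) := by
        calc m / K * V t ≤ m / K * (K * (g t ^ 2 + p t ^ 2)) := by gcongr; exact hup t
          _ = _ := by field_simp
      have h2 : m * g t ^ 2 ≤ c * g t ^ 2 := by gcongr; exact min_le_right _ _
      have h3 : m * p t ^ 2 ≤ 1 * p t ^ 2 := by gcongr; exact min_le_left _ _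
      linarith
  set a : ℝ := min 1 (1 / (2 * c)) with ha
  have hapos : 0 < a := lt_min one_pos (by positivity)
  have hexp : Tendsto (fun t : ℝ => V 0 / a * Real.exp (-(m / K * t))) atTop (𝓝 0) := by
    have : Tendsto (fun t : ℝ => m / K * t) atTop atTop :=
      tendsto_id.const_mul_atTop (by positivity)
    simpa using (Real.tendsto_exp_neg_atTop_nhds_zero.comp this).const_mul (V 0 / a)
  refine squeeze_zero' (Eventually.of_forall fun t => by positivity) ?_ hexp
  filter_upwards [eventually_ge_atTop 0] with t ht
  have h1 := hdec ht
  simp only [mul_zero, Real.exp_zero, one_mul] at h1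
  have h2 := hlow t
  rw [Real.exp_neg, div_mul_eq_mul_div, le_div_iff₀ hapos, ← div_eq_mul_inv,
    le_div_iff₀ (Real.exp_pos _)]
  have h3 := mul_le_mul_of_nonneg_left h2 (Real.exp_pos (m / K * t)).le
  linarith

theorem tendsto_fst (h : IsImpulseResponse c g p) (hc : 0 < c) : Tendsto g atTop (𝓝 0) := by
  have h1 : Tendsto (fun t => g t ^ 2) atTop (𝓝 0) :=
    squeeze_zero (fun t => sq_nonneg _) (fun t => le_add_of_nonneg_right (sq_nonneg _))
      (h.tendsto_sq_add_sq hc)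
  have := h1.sqrt
  simp only [Real.sqrt_sq_eq_abs, Real.sqrt_zero] at this
  exact (tendsto_zero_iff_abs_tendsto_zero _).2 this

theorem tendsto_snd (h : IsImpulseResponse c g p) (hc : 0 < c) : Tendsto p atTop (𝓝 0) := by
  have h1 : Tendsto (fun t => p t ^ 2) atTop (𝓝 0) :=
    squeeze_zero (fun t => sq_nonneg _) (fun t => le_add_of_nonneg_left (sq_nonneg _))
      (h.tendsto_sq_add_sq hc)
  have := h1.sqrt
  simp only [Real.sqrt_sq_eq_abs, Real.sqrt_zero] at this
  exact (tendsto_zero_iff_abs_tendsto_zero _).2 this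

/-- The energy of the impulse response is `1 / (2 c²)`. -/
theorem tendsto_integral_sq (h : IsImpulseResponse c g p) (hc : 0 < c) :
    Tendsto (fun t => ∫ s in (0 : ℝ)..t, g s ^ 2) atTop (𝓝 (1 / 2 * c⁻¹ ^ 2)) := by
  -- An explicit antiderivative of `g²`: halving the energy part of `V` cancels the `p²` term and
  -- leaves derivative `-c g²` inside the parentheses.
  let F : ℝ → ℝ := fun t => -((g t ^ 2 / 2 + p t ^ 2 / (2 * c) + g t * p t + c / 2 * g t ^ 2) / c)
  have hF : ∀ t, HasDerivAt F (g t ^ 2) t := by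
    intro t
    have h1 := h.hasDerivAt_fst t
    have h2 := h.hasDerivAt_snd t
    refine ((((((h1.pow 2).div_const 2).add ((h2.pow 2).div_const (2 * c))).add (h1.mul h2)).add
      ((h1.pow 2).const_mul (c / 2))).div_const c).neg |>.congr_deriv ?_
    field_simp
    push_cast
    ring
  have hint : ∀ t, ∫ s in (0 : ℝ)..t, g s ^ 2 = F t - F 0 := fun t =>
    intervalIntegral.integral_eq_sub_of_hasDerivAt (fun s _ => hF s)
      ((h.continuous_fst.pow 2).intervalIntegrable _ _)
  simp_rw [hint]
  have hg := h.tendsto_fst hc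
  have hp := h.tendsto_snd hc
  have hlim : Tendsto F atTop (𝓝 0) := by
    have := (((((hg.pow 2).div_const 2).add ((hp.pow 2).div_const (2 * c))).add (hg.mul hp)).add
      ((hg.pow 2).const_mul (c / 2))).div_const c |>.neg
    simpa using this
  have h0 : F 0 = -(1 / 2 * c⁻¹ ^ 2) := by
    simp only [F, h.fst_zero, h.snd_zero]; field_simp; ring
  simpa [h0] using hlim.sub_const (F 0)

theorem hasDerivAt_fst_comp_sub (h : IsImpulseResponse c g p) (t s : ℝ) :
    HasDerivAt (fun s => -g (t - s)) (p (t - s)) s := by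
  simpa using ((h.hasDerivAt_fst (t - s)).comp_const_sub t s).fun_neg

/-- Integration by parts on each side of `r`; the boundary terms `± r g(t - r)` cancel and `g 0 = 0`
kills the one at `t`. -/
theorem integral_snd_mul_min (h : IsImpulseResponse c g p) {t r : ℝ} (hr : 0 ≤ r) (hrt : r ≤ t) :
    ∫ s in (0 : ℝ)..t, p (t - s) * min s r = ∫ s in (0 : ℝ)..r, g (t - s) := by
  have hpc : Continuous fun s => p (t - s) := h.continuous_snd.comp (by fun_prop)
  have hgc : Continuous fun s => g (t - s) := h.continuous_fst.comp (by fun_prop)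
  have hc : Continuous fun s => p (t - s) * min s r := hpc.mul (by fun_prop)
  rw [← intervalIntegral.integral_add_adjacent_intervals (hc.intervalIntegrable 0 r)
    (hc.intervalIntegrable r t)]
  have h1 : ∫ s in (0 : ℝ)..r, p (t - s) * min s r = -(g (t - r) * r) + ∫ s in (0 : ℝ)..r, g (t - s) := by
    have e : ∫ s in (0 : ℝ)..r, p (t - s) * min s r = ∫ s in (0 : ℝ)..r, s * p (t - s) := by
      refine intervalIntegral.integral_congr fun s hs => ?_
      rw [Set.uIcc_of_le hr] at hs
      simp only [min_eq_left hs.2]; ring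
    rw [e, intervalIntegral.integral_mul_deriv_eq_deriv_mul (u := fun s => s) (u' := fun _ => 1)
      (fun s _ => hasDerivAt_id s) (fun s _ => h.hasDerivAt_fst_comp_sub t s)
      (continuous_const.intervalIntegrable _ _) (hpc.intervalIntegrable _ _)]
    simp; ring
  have h2 : ∫ s in r..t, p (t - s) * min s r = g (t - r) * r := by
    have e : ∫ s in r..t, p (t - s) * min s r = ∫ s in r..t, p (t - s) * r := by
      refine intervalIntegral.integral_congr fun s hs => ?_
      rw [Set.uIcc_of_le hrt] at hs
      simp only [min_eq_right hs.1]
    rw [e, intervalIntegral.integral_mul_const, intervalIntegral.integral_eq_sub_of_hasDerivAt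
      (fun s _ => h.hasDerivAt_fst_comp_sub t s) (hpc.intervalIntegrable _ _)]
    simp [h.fst_zero]
  rw [h1, h2]; ring

/-- The Brownian covariance kernel integrated against the velocity response. -/
theorem integral_integral_snd_mul_min (h : IsImpulseResponse c g p) {t : ℝ} (ht : 0 ≤ t) :
    ∫ r in (0 : ℝ)..t, ∫ s in (0 : ℝ)..t, p (t - r) * p (t - s) * min s r
      = ∫ s in (0 : ℝ)..t, g s ^ 2 := by
  have hpc : Continuous fun s => p (t - s) := h.continuous_snd.comp (by fun_prop)
  have hgc : Continuous fun s => g (t - s) := h.continuous_fst.comp (by fun_prop)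
  have e : ∫ r in (0 : ℝ)..t, ∫ s in (0 : ℝ)..t, p (t - r) * p (t - s) * min s r
      = ∫ r in (0 : ℝ)..t, (∫ s in (0 : ℝ)..r, g (t - s)) * p (t - r) := by
    refine intervalIntegral.integral_congr fun r hr => ?_
    rw [Set.uIcc_of_le ht] at hr
    simp only [mul_assoc]
    rw [intervalIntegral.integral_const_mul, h.integral_snd_mul_min hr.1 hr.2]; ring
  -- The second integration by parts has no boundary terms: `g 0 = 0` at `r = t`, an empty integral
  -- at `r = 0`.
  rw [e, intervalIntegral.integral_mul_deriv_eq_deriv_mul (u' := fun r => g (t - r))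
      (fun s _ => intervalIntegral.integral_hasDerivAt_right (hgc.intervalIntegrable _ _)
        (hgc.stronglyMeasurableAtFilter _ _) hgc.continuousAt)
      (fun s _ => h.hasDerivAt_fst_comp_sub t s)
      (hgc.intervalIntegrable _ _) (hpc.intervalIntegrable _ _)]
  have e2 : ∫ s in (0 : ℝ)..t, g s ^ 2 = ∫ s in (0 : ℝ)..t, g (t - s) ^ 2 := by
    rw [intervalIntegral.integral_comp_sub_left (fun s => g s ^ 2)]; simp
  rw [e2]
  simp [h.fst_zero, pow_two]

/-- Variation of constants for a forced oscillator with continuous forcing, where the noise enters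
in integrated form. -/
theorem eq_add_integral (h : IsImpulseResponse c g p) {y z b : ℝ → ℝ}
    (hy : Continuous y) (hz : Continuous z) (hb : Continuous b) {t : ℝ} (ht : 0 ≤ t)
    (hy_eq : ∀ s, 0 ≤ s → y s = y 0 + ∫ r in (0 : ℝ)..s, z r)
    (hz_eq : ∀ s, 0 ≤ s → z s = z 0 + (∫ r in (0 : ℝ)..s, (-(c * y r) - c * z r)) + b s) :
    y t = ((p t + c * g t) * y 0 + g t * z 0) + ∫ s in (0 : ℝ)..t, p (t - s) * b s := by
  -- `Z = z - b` on `[0, t]` is differentiable although `z` and `b` need not be.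
  let Y : ℝ → ℝ := fun s => y 0 + ∫ r in (0 : ℝ)..s, z r
  let Z : ℝ → ℝ := fun s => z 0 + ∫ r in (0 : ℝ)..s, (-(c * y r) - c * z r)
  have hf : Continuous fun r => -(c * y r) - c * z r := by fun_prop
  have hY : ∀ s, HasDerivAt Y (z s) s := fun s =>
    (intervalIntegral.integral_hasDerivAt_right (hz.intervalIntegrable _ _)
        (hz.stronglyMeasurableAtFilter _ _) hz.continuousAt).const_add _
  have hZ : ∀ s, HasDerivAt Z (-(c * y s) - c * z s) s := fun s =>
    (intervalIntegral.integral_hasDerivAt_right (hf.intervalIntegrable _ _)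
        (hf.stronglyMeasurableAtFilter _ _) hf.continuousAt).const_add _
  have hpc : Continuous fun s => p (t - s) := h.continuous_snd.comp (by fun_prop)
  -- The function of `s` is the position reached at time `t` by the unforced flow started at `(Y s,
  -- Z s)` at time `s`. It changes only through the mismatch `Y' = Z + b`.
  have hder : ∀ s ∈ Set.uIcc 0 t, HasDerivAt
      (fun s => (p (t - s) + c * g (t - s)) * Y s + g (t - s) * Z s) (p (t - s) * b s) s := by
    intro s hs
    rw [Set.uIcc_of_le ht] at hs
    have h1 := (h.hasDerivAt_fst (t - s)).comp_const_sub t s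
    have h2 := (h.hasDerivAt_snd (t - s)).comp_const_sub t s
    refine (((h2.add (h1.const_mul c)).mul (hY s)).add (h1.mul (hZ s))).congr_deriv ?_
    have e1 : Y s = y s := (hy_eq s hs.1).symm
    have e2 : Z s = z s - b s := by rw [hz_eq s hs.1]; simp [Z]
    simp only [Pi.add_apply, e1, e2]
    ring
  have := intervalIntegral.integral_eq_sub_of_hasDerivAt hder ((hpc.mul hb).intervalIntegrable _ _)
  rw [this, hy_eq t ht]
  simp only [sub_self, h.fst_zero, h.snd_zero, sub_zero, Y, Z, intervalIntegral.integral_same]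
  ring

end IsImpulseResponse

/-! ### Second moments of noise integrals -/

section Moments

variable {Ω : Type*} [MeasurableSpace Ω] {P : Measure Ω}

/-- Fubini needs joint measurability. Off a null set the paths are continuous and agree with
measurable versions at rational times; setting the process to zero on that set and taking limits
along rationals suffices. -/
theorem exists_measurable_uncurry_eq {β : ℝ → Ω → ℝ} (hm : ∀ t, AEMeasurable (β t) P)
    (hc : ∀ᵐ ω ∂P, Continuous fun t => β t ω) :
    ∃ β' : ℝ → Ω → ℝ, Measurable (Function.uncurry β') ∧
      ∀ᵐ ω ∂P, ∀ t, β t ω = β' t ω := by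
  classical
  have hq : ∀ᵐ ω ∂P, ∀ q : ℚ, β q ω = (hm q).mk (β q) ω := ae_all_iff.2 fun q => (hm q).ae_eq_mk
  obtain ⟨S, hS, hSm, hS0⟩ := exists_measurable_superset_of_null (ae_iff.1 (hc.and hq))
  have hgood : ∀ ω ∉ S, (Continuous fun t => β t ω) ∧ ∀ q : ℚ, β q ω = (hm q).mk (β q) ω := by
    intro ω hω
    by_contra hcon
    exact hω (hS hcon)
  let β' : ℝ → Ω → ℝ := fun t => Sᶜ.indicator (β t)
  have hcont : ∀ ω, Continuous fun t => β' t ω := by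
    intro ω
    by_cases hω : ω ∈ S
    · simpa [β', hω] using continuous_const
    · simpa [β', hω] using (hgood ω hω).1
  have hrat : ∀ q : ℚ, Measurable (β' q) := by
    intro q
    have : β' q = Sᶜ.indicator ((hm q).mk (β q)) := by
      ext ω
      by_cases hω : ω ∈ S
      · simp [β', hω]
      · simpa [β', hω] using (hgood ω hω).2 q
    rw [this]
    exact (hm q).measurable_mk.indicator hSm.compl
  have hmeas : ∀ t, Measurable (β' t) := by
    intro t
    obtain ⟨u, hu⟩ : ∃ u : ℕ → ℚ, Tendsto (fun n => (u n : ℝ)) atTop (𝓝 t) := by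
      obtain ⟨u, hu, hut⟩ := mem_closure_iff_seq_limit.1 (Rat.denseRange_cast (𝕜 := ℝ) t)
      choose v hv using hu
      exact ⟨v, by simpa [hv] using hut⟩
    exact measurable_of_tendsto_metrizable (fun n => hrat (u n))
      (tendsto_pi_nhds.2 fun ω => ((hcont ω).tendsto t).comp hu)
  refine ⟨β', measurable_uncurry_of_continuous_of_measurable hcont hmeas, ?_⟩
  filter_upwards [measure_eq_zero_iff_ae_notMem.1 hS0] with ω hω t
  simp [β', hω]

/-- Second moment of a weighted time integral of a process with the Brownian covariance. -/
theorem memLp_and_integral_sq_of_measurable_uncurry [IsProbabilityMeasure P] {β : ℝ → Ω → ℝ}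
    (hβ : Measurable (Function.uncurry β)) (hL : ∀ s, 0 ≤ s → MemLp (β s) 2 P)
    (hcov : ∀ s r, 0 ≤ s → 0 ≤ r → ∫ ω, β s ω * β r ω ∂P = min s r)
    {k : ℝ → ℝ} (hk : Continuous k) {t : ℝ} (ht : 0 ≤ t) :
    MemLp (fun ω => ∫ s in (0 : ℝ)..t, k s * β s ω) 2 P ∧
      ∫ ω, (∫ s in (0 : ℝ)..t, k s * β s ω) ^ 2 ∂P
        = ∫ r in (0 : ℝ)..t, ∫ s in (0 : ℝ)..t, k r * k s * min s r := by
  simp only [intervalIntegral.integral_of_le ht]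
  set μ : Measure ℝ := volume.restrict (Set.Ioc 0 t) with hμ
  -- The square of the time integral is the integral of `F` over the square of times.
  let F : Ω × (ℝ × ℝ) → ℝ := fun q => (k q.2.1 * β q.2.1 q.1) * (k q.2.2 * β q.2.2 q.1)
  have hk' : Measurable k := hk.measurable
  have hB : Measurable fun q : Ω × ℝ => k q.2 * β q.2 q.1 :=
    (hk'.comp measurable_snd).mul (hβ.comp (measurable_snd.prodMk measurable_fst))
  have hFm : Measurable F :=
    (hB.comp (measurable_fst.prodMk (measurable_fst.comp measurable_snd))).mul
      (hB.comp (measurable_fst.prodMk (measurable_snd.comp measurable_snd)))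
  have hmem : ∀ᵐ q ∂(μ.prod μ), q.1 ∈ Set.Ioc 0 t ∧ q.2 ∈ Set.Ioc 0 t := by
    rw [hμ, Measure.prod_restrict]
    exact ae_restrict_mem (measurableSet_Ioc.prod measurableSet_Ioc)
  obtain ⟨K, hK⟩ := isCompact_Icc.exists_bound_of_continuousOn (s := Set.Icc 0 t) hk.continuousOn
  have hF : Integrable F (P.prod (μ.prod μ)) := by
    rw [integrable_prod_iff' hFm.aestronglyMeasurable]
    constructor
    · filter_upwards [hmem] with q hq
      exact ((hL q.1 hq.1.1.le).const_mul (k q.1)).integrable_mul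
        ((hL q.2 hq.2.1.le).const_mul (k q.2))
    · refine Integrable.of_bound (C := K * K * t)
        hFm.norm.stronglyMeasurable.integral_prod_left'.aestronglyMeasurable ?_
      filter_upwards [hmem] with q hq
      have h1 := hL q.1 hq.1.1.le
      have h2 := hL q.2 hq.2.1.le
      have hK1 := hK q.1 ⟨hq.1.1.le, hq.1.2⟩
      have hK2 := hK q.2 ⟨hq.2.1.le, hq.2.2⟩
      have hK0 : 0 ≤ K := (norm_nonneg _).trans hK1
      rw [Real.norm_of_nonneg (integral_nonneg fun _ => norm_nonneg _)]
      calc ∫ ω, ‖F (ω, q)‖ ∂P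
          ≤ ∫ ω, K * K * ((β q.1 ω ^ 2 + β q.2 ω ^ 2) / 2) ∂P := by
            refine integral_mono_of_nonneg (Eventually.of_forall fun _ => norm_nonneg _)
              (((h1.integrable_sq.add h2.integrable_sq).div_const 2).const_mul _)
              (Eventually.of_forall fun ω => ?_)
            simp only [F, norm_mul]
            -- AM-GM reduces the mixed moment to the variances `𝔼 β_s² = s ≤ t`, which makes `F`
            -- integrable on the product.
            have h3 : ‖β q.1 ω‖ * ‖β q.2 ω‖ ≤ (β q.1 ω ^ 2 + β q.2 ω ^ 2) / 2 := by
              have := sq_nonneg (‖β q.1 ω‖ - ‖β q.2 ω‖)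
              have e1 : ‖β q.1 ω‖ ^ 2 = β q.1 ω ^ 2 := by simp
              have e2 : ‖β q.2 ω‖ ^ 2 = β q.2 ω ^ 2 := by simp
              nlinarith
            calc ‖k q.1‖ * ‖β q.1 ω‖ * (‖k q.2‖ * ‖β q.2 ω‖)
                = (‖k q.1‖ * ‖k q.2‖) * (‖β q.1 ω‖ * ‖β q.2 ω‖) := by ring
              _ ≤ (K * K) * ((β q.1 ω ^ 2 + β q.2 ω ^ 2) / 2) := by gcongr
        _ = K * K * ((q.1 + q.2) / 2) := by
            have e : ∀ s, 0 ≤ s → ∫ ω, β s ω ^ 2 ∂P = s := fun s hs => by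
              simpa [pow_two] using hcov s s hs hs
            rw [integral_const_mul, integral_div, integral_add h1.integrable_sq h2.integrable_sq,
              e _ hq.1.1.le, e _ hq.2.1.le]
        _ ≤ K * K * t := by
            have := hq.1.2
            have := hq.2.2
            gcongr
            linarith
  have hsq : ∀ ω, (∫ s, k s * β s ω ∂μ) ^ 2 = ∫ q, F (ω, q) ∂(μ.prod μ) := fun ω => by
    rw [pow_two, ← integral_prod_mul]
  constructor
  · rw [memLp_two_iff_integrable_sq hB.stronglyMeasurable.integral_prod_right'.aestronglyMeasurable]
    simp only [hsq]
    exact hF.integral_prod_left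
  · simp only [hsq]
    rw [integral_integral_swap (f := fun ω q => F (ω, q)) hF]
    have e : (fun q : ℝ × ℝ => ∫ ω, F (ω, q) ∂P) =ᵐ[μ.prod μ]
        fun q => k q.1 * k q.2 * min q.2 q.1 := by
      filter_upwards [hmem] with q hq
      rw [min_comm, ← hcov q.1 q.2 hq.1.1.le hq.2.1.le, ← integral_const_mul]
      congr 1; ext ω; simp only [F]; ring
    rw [integral_congr_ae e, integral_prod]
    exact hF.integral_prod_right.congr e

/-- Second moment of a weighted time integral of a process with the Brownian covariance. -/
theorem memLp_and_integral_sq [IsProbabilityMeasure P] {β : ℝ → Ω → ℝ}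
    (hc : ∀ᵐ ω ∂P, Continuous fun t => β t ω) (hm : ∀ s, AEMeasurable (β s) P)
    (hL : ∀ s, 0 ≤ s → MemLp (β s) 2 P)
    (hcov : ∀ s r, 0 ≤ s → 0 ≤ r → ∫ ω, β s ω * β r ω ∂P = min s r)
    {k : ℝ → ℝ} (hk : Continuous k) {t : ℝ} (ht : 0 ≤ t) :
    MemLp (fun ω => ∫ s in (0 : ℝ)..t, k s * β s ω) 2 P ∧
      ∫ ω, (∫ s in (0 : ℝ)..t, k s * β s ω) ^ 2 ∂P
        = ∫ r in (0 : ℝ)..t, ∫ s in (0 : ℝ)..t, k r * k s * min s r := by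
  obtain ⟨β', hβ', hae⟩ := exists_measurable_uncurry_eq hm hc
  have hs : ∀ s, β s =ᵐ[P] β' s := fun s => by filter_upwards [hae] with ω h using h s
  have := memLp_and_integral_sq_of_measurable_uncurry hβ' (fun s h => (memLp_congr_ae (hs s)).1 (hL s h))
    (fun s r h1 h2 => by
      rw [← hcov s r h1 h2]
      refine integral_congr_ae ?_
      filter_upwards [hae] with ω h
      rw [h, h]) hk ht
  have e : (fun ω => ∫ s in (0 : ℝ)..t, k s * β s ω) =ᵐ[P] fun ω => ∫ s in (0 : ℝ)..t, k s * β' s ω := by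
    filter_upwards [hae] with ω h
    simp only [h]
  refine ⟨(memLp_congr_ae e).2 this.1, ?_⟩
  rw [← this.2]
  refine integral_congr_ae ?_
  filter_upwards [e] with ω h
  rw [h]

theorem abs_integral_mul_le_sqrt {f g : Ω → ℝ} (hf : MemLp f 2 P) (hg : MemLp g 2 P) :
    |∫ ω, f ω * g ω ∂P| ≤ √(∫ ω, f ω ^ 2 ∂P) * √(∫ ω, g ω ^ 2 ∂P) := by
  have h := integral_mul_norm_le_Lp_mul_Lq (μ := P) (f := f) (g := g) Real.HolderConjugate.two_two
    (by simpa using hf) (by simpa using hg)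
  refine (abs_integral_le_integral_abs).trans ?_
  simpa [Real.sqrt_eq_rpow, abs_mul] using h

/-- Perturbing a process by a mean-square vanishing one does not change the limit of its second
moments. -/
theorem tendsto_integral_add_sq {ι : Type*} {l : Filter ι} {a Y : ι → Ω → ℝ} {m : ℝ}
    (ha : ∀ t, MemLp (a t) 2 P) (hY : ∀ t, MemLp (Y t) 2 P)
    (ha0 : Tendsto (fun t => ∫ ω, a t ω ^ 2 ∂P) l (𝓝 0))
    (hYm : Tendsto (fun t => ∫ ω, Y t ω ^ 2 ∂P) l (𝓝 m)) :
    Tendsto (fun t => ∫ ω, (a t ω + Y t ω) ^ 2 ∂P) l (𝓝 m) := by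
  have e : ∀ t, ∫ ω, (a t ω + Y t ω) ^ 2 ∂P
      = (∫ ω, a t ω ^ 2 ∂P) + 2 * (∫ ω, a t ω * Y t ω ∂P) + ∫ ω, Y t ω ^ 2 ∂P := by
    intro t
    have i1 : Integrable (fun ω => 2 * (a t ω * Y t ω)) P :=
      ((ha t).integrable_mul (hY t)).const_mul 2
    rw [← integral_const_mul, ← integral_add (ha t).integrable_sq i1,
      ← integral_add ((ha t).integrable_sq.fun_add i1) (hY t).integrable_sq]
    congr 1; ext ω; ring
  have hcross : Tendsto (fun t => ∫ ω, a t ω * Y t ω ∂P) l (𝓝 0) := by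
    refine squeeze_zero_norm (fun t => abs_integral_mul_le_sqrt (ha t) (hY t)) ?_
    simpa using ha0.sqrt.mul hYm.sqrt
  simp_rw [e]
  simpa using (ha0.add (hcross.const_mul 2)).add hYm

/-- The second moment of a noisy damped oscillator converges to `1 / (2 c²)`. -/
theorem tendsto_integral_sq_oscillator [IsProbabilityMeasure P] {c : ℝ} (hc : 0 < c)
    {y z b : ℝ≥0 → Ω → ℝ} (hy : ∀ᵐ ω ∂P, Continuous fun t => y t ω)
    (hz : ∀ᵐ ω ∂P, Continuous fun t => z t ω) (hb : ∀ᵐ ω ∂P, Continuous fun t => b t ω)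
    (hy_eq : ∀ᵐ ω ∂P, ∀ t : ℝ≥0, y t ω = y 0 ω + ∫ s in (0 : ℝ)..t, z s.toNNReal ω)
    (hz_eq : ∀ᵐ ω ∂P, ∀ t : ℝ≥0, z t ω = z 0 ω
      + (∫ s in (0 : ℝ)..t, (-(c * y s.toNNReal ω) - c * z s.toNNReal ω)) + b t ω)
    (hy0 : MemLp (y 0) 2 P) (hz0 : MemLp (z 0) 2 P) (hbL : ∀ t, MemLp (b t) 2 P)
    (hcov : ∀ s t, ∫ ω, b s ω * b t ω ∂P = min s t) :
    (∀ t, MemLp (y t) 2 P) ∧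
      Tendsto (fun t => ∫ ω, y t ω ^ 2 ∂P) atTop (𝓝 (1 / 2 * c⁻¹ ^ 2)) := by
  obtain ⟨g, p, h⟩ := exists_isImpulseResponse c
  -- `a` is the free response to the initial state, `Y` the response to the noise.
  let a : ℝ≥0 → Ω → ℝ := fun t ω => (p t + c * g t) * y 0 ω + g t * z 0 ω
  let Y : ℝ≥0 → Ω → ℝ := fun t ω => ∫ s in (0 : ℝ)..t, p (t - s) * b s.toNNReal ω
  have hrep : ∀ t, y t =ᵐ[P] fun ω => a t ω + Y t ω := by
    intro t
    filter_upwards [hy, hz, hb, hy_eq, hz_eq] with ω h1 h2 h3 h4 h5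
    have := h.eq_add_integral (y := fun s => y s.toNNReal ω) (z := fun s => z s.toNNReal ω)
      (b := fun s => b s.toNNReal ω) (h1.comp continuous_real_toNNReal)
      (h2.comp continuous_real_toNNReal) (h3.comp continuous_real_toNNReal) t.coe_nonneg
      (fun s hs => by simpa [Real.coe_toNNReal s hs] using h4 s.toNNReal)
      (fun s hs => by simpa [Real.coe_toNNReal s hs] using h5 s.toNNReal)
    simpa [a, Y] using this
  have hmom : ∀ t : ℝ≥0, MemLp (Y t) 2 P ∧ ∫ ω, Y t ω ^ 2 ∂P = ∫ s in (0 : ℝ)..t, g s ^ 2 := by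
    intro t
    have := memLp_and_integral_sq (P := P) (β := fun s => b s.toNNReal) (k := fun s => p (t - s))
      (hb.mono fun ω h => h.comp continuous_real_toNNReal) (fun s => (hbL _).aemeasurable)
      (fun s _ => hbL _) (fun s r hs hr => by
        rw [hcov, NNReal.coe_min, Real.coe_toNNReal s hs, Real.coe_toNNReal r hr])
      (h.continuous_snd.comp (by fun_prop)) t.coe_nonneg
    rwa [h.integral_integral_snd_mul_min t.coe_nonneg] at this
  have haL : ∀ t, MemLp (a t) 2 P := fun t => (hy0.const_mul _).add (hz0.const_mul _)
  have hg := (h.tendsto_fst hc).comp (NNReal.tendsto_coe_atTop.2 tendsto_id)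
  have hp := (h.tendsto_snd hc).comp (NNReal.tendsto_coe_atTop.2 tendsto_id)
  have ha0 : Tendsto (fun t => ∫ ω, a t ω ^ 2 ∂P) atTop (𝓝 0) := by
    have e : ∀ t, ∫ ω, a t ω ^ 2 ∂P = (p t + c * g t) ^ 2 * (∫ ω, y 0 ω ^ 2 ∂P)
        + 2 * (p t + c * g t) * g t * (∫ ω, y 0 ω * z 0 ω ∂P) + g t ^ 2 * ∫ ω, z 0 ω ^ 2 ∂P := by
      intro t
      have i1 := hy0.integrable_sq.const_mul ((p t + c * g t) ^ 2)
      have i2 : Integrable (fun ω => 2 * (p t + c * g t) * g t * (y 0 ω * z 0 ω)) P :=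
        (hy0.integrable_mul hz0).const_mul _
      have i3 := hz0.integrable_sq.const_mul (g t ^ 2)
      simp only [← integral_const_mul]
      rw [← integral_add i1 i2, ← integral_add (i1.fun_add i2) i3]
      congr 1; ext ω; simp only [a]; ring
    simp_rw [e]
    have hh := hp.add (hg.const_mul c)
    simpa using (((hh.pow 2).mul_const (∫ ω, y 0 ω ^ 2 ∂P)).add
      (((hh.const_mul 2).mul hg).mul_const (∫ ω, y 0 ω * z 0 ω ∂P))).add
      ((hg.pow 2).mul_const (∫ ω, z 0 ω ^ 2 ∂P))
  refine ⟨fun t => (memLp_congr_ae (hrep t)).2 ((haL t).add (hmom t).1), ?_⟩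
  have hY2 : Tendsto (fun t => ∫ ω, Y t ω ^ 2 ∂P) atTop (𝓝 (1 / 2 * c⁻¹ ^ 2)) := by
    simp_rw [fun t => (hmom t).2]
    exact (h.tendsto_integral_sq hc).comp (NNReal.tendsto_coe_atTop.2 tendsto_id)
  refine (tendsto_integral_add_sq haL (fun t => (hmom t).1) ha0 hY2).congr fun t => ?_
  refine integral_congr_ae ?_
  filter_upwards [hrep t] with ω hω
  rw [hω]

/-- A unit vector `u` projects a standard Brownian motion to a process with the covariance of a
standard real Brownian motion. -/
theorem IsStandardBrownianMotion.memLp_and_covariance_projection {N : ℕ} [IsProbabilityMeasure P]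
    {W : ℝ≥0 → Ω → Fin N → ℝ} (hW : IsStandardBrownianMotion W P) {u : Fin N → ℝ}
    (hu : ∑ j, u j ^ 2 = 1) :
    (∀ t, MemLp (fun ω => ∑ j, u j * W t ω j) 2 P) ∧
      ∀ s t, ∫ ω, (∑ j, u j * W s ω j) * (∑ j, u j * W t ω j) ∂P = min s t := by
  have hL : ∀ t j, MemLp (fun ω => W t ω j) 2 P := fun t j =>
    ((hW.isBrownianReal j).hasLaw_eval t).hasGaussianLaw.memLp_two
  have h0 : ∀ t j, ∫ ω, W t ω j ∂P = 0 := fun t j => (hW.isBrownianReal j).integral_eval t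
  have hWW : ∀ s t j k, ∫ ω, W s ω j * W t ω k ∂P = if j = k then ((min s t : ℝ≥0) : ℝ) else 0 := by
    intro s t j k
    split_ifs with hjk
    · subst hjk
      have := (hW.isBrownianReal j).covariance_fun_eval s t
      rw [covariance_eq_sub (hL s j) (hL t j)] at this
      simpa [h0] using this
    · have hind := (hW.iIndepFun.indepFun hjk).comp (measurable_pi_apply s) (measurable_pi_apply t)
      have := hind.integral_mul_eq_mul_integral (hL s j).1 (hL t k).1
      simpa [Function.comp_def, h0] using this
  refine ⟨fun t => memLp_finsetSum _ fun j _ => (hL t j).const_mul (u j), fun s t => ?_⟩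
  simp only [Finset.sum_mul_sum]
  have hint : ∀ j k, Integrable (fun ω => u j * W s ω j * (u k * W t ω k)) P := fun j k =>
    ((hL s j).const_mul _).integrable_mul ((hL t k).const_mul _)
  rw [integral_finsetSum _ fun j _ => integrable_finsetSum _ fun k _ => hint j k]
  have hterm : ∀ j k, ∫ ω, u j * W s ω j * (u k * W t ω k) ∂P
      = u j * u k * if j = k then ((min s t : ℝ≥0) : ℝ) else 0 := by
    intro j k
    rw [← hWW, ← integral_const_mul]
    congr 1; ext ω; ring
  simp_rw [integral_finsetSum _ fun k _ => hint _ k, hterm]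
  simp only [mul_ite, mul_zero, Finset.sum_ite_eq, Finset.mem_univ, if_true]
  rw [← Finset.sum_mul]
  simp only [← pow_two, hu, one_mul]

end Moments

/-! ### Spectral theory of the Laplacian -/

section Spectrum

variable {N : ℕ} (G : SimpleGraph (Fin N)) [DecidableRel G.Adj]

/-- The eigenvalues of the Laplacian, indexed as the columns of `lapEigenvectors`. -/
noncomputable def lapSpectrum : Fin N → ℝ := (G.isHermitian_lapMatrix ℝ).eigenvalues

/-- The orthogonal matrix whose columns are eigenvectors of the Laplacian. -/
noncomputable def lapEigenvectors : Matrix (Fin N) (Fin N) ℝ :=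
  (G.isHermitian_lapMatrix ℝ).eigenvectorUnitary

theorem transpose_lapEigenvectors_mul : (lapEigenvectors G)ᵀ * lapEigenvectors G = 1 :=
  Unitary.coe_star_mul_self (G.isHermitian_lapMatrix ℝ).eigenvectorUnitary

theorem lapEigenvectors_mul_transpose : lapEigenvectors G * (lapEigenvectors G)ᵀ = 1 :=
  Unitary.coe_mul_star_self (G.isHermitian_lapMatrix ℝ).eigenvectorUnitary

theorem lapMatrix_eq :
    G.lapMatrix ℝ = lapEigenvectors G * diagonal (lapSpectrum G) * (lapEigenvectors G)ᵀ := by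
  have hL := (G.isHermitian_lapMatrix ℝ).spectral_theorem
  rw [Unitary.conjStarAlgAut_apply] at hL
  exact hL

theorem lapPseudoInverse_eq : lapPseudoInverse G =
    lapEigenvectors G * diagonal (fun i => (lapSpectrum G i)⁻¹) * (lapEigenvectors G)ᵀ := rfl

theorem sum_lapEigenvectors_sq (i : Fin N) : ∑ j, lapEigenvectors G j i ^ 2 = 1 := by
  have := congrFun (congrFun (transpose_lapEigenvectors_mul G) i) i
  simpa [Matrix.mul_apply, pow_two] using this

theorem transpose_lapEigenvectors_mulVec_lapMatrix (w : Fin N → ℝ) (i : Fin N) :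
    ((lapEigenvectors G)ᵀ *ᵥ (G.lapMatrix ℝ *ᵥ w)) i
      = lapSpectrum G i * ((lapEigenvectors G)ᵀ *ᵥ w) i := by
  conv_lhs => rw [lapMatrix_eq, mulVec_mulVec, ← Matrix.mul_assoc, ← Matrix.mul_assoc,
    transpose_lapEigenvectors_mul, Matrix.one_mul, ← mulVec_mulVec, mulVec_diagonal]

theorem lapMatrix_mulVec_lapEigenvectors (i : Fin N) :
    G.lapMatrix ℝ *ᵥ (fun j => lapEigenvectors G j i)
      = lapSpectrum G i • fun j => lapEigenvectors G j i := by
  have h : G.lapMatrix ℝ * lapEigenvectors G = lapEigenvectors G * diagonal (lapSpectrum G) := by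
    conv_lhs => rw [lapMatrix_eq, Matrix.mul_assoc, transpose_lapEigenvectors_mul, Matrix.mul_one]
  ext k
  have := congrFun (congrFun h k) i
  rw [mul_diagonal] at this
  rw [Pi.smul_apply, smul_eq_mul, mul_comm, ← this]
  rfl

theorem lapSpectrum_nonneg (i : Fin N) : 0 ≤ lapSpectrum G i :=
  (G.posSemidef_lapMatrix ℝ).eigenvalues_nonneg i

/-- `L 1 = 0`, so constants are orthogonal to every other eigenspace. -/
theorem transpose_lapEigenvectors_mulVec_one {i : Fin N} (hi : lapSpectrum G i ≠ 0) :
    ∑ j, lapEigenvectors G j i = 0 := by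
  have h := transpose_lapEigenvectors_mulVec_lapMatrix G (fun _ => 1) i
  rw [G.lapMatrix_mulVec_const_eq_zero, mulVec_zero, Pi.zero_apply, eq_comm, mul_eq_zero] at h
  simpa [mulVec, dotProduct] using h.resolve_left hi

/-- Otherwise the nonzero constant vector would be orthogonal to a full eigenbasis. -/
theorem exists_lapSpectrum_eq_zero [NeZero N] : ∃ i, lapSpectrum G i = 0 := by
  by_contra! hne
  have h : (lapEigenvectors G)ᵀ *ᵥ (fun _ => (1 : ℝ)) = 0 := by
    ext i
    simpa [mulVec, dotProduct] using transpose_lapEigenvectors_mulVec_one G (hne i)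
  have h1 := congrArg (lapEigenvectors G *ᵥ ·) h
  simp only [mulVec_mulVec, lapEigenvectors_mul_transpose, one_mulVec, mulVec_zero] at h1
  simpa using congrFun h1 0

theorem lapEigenvalue_zero [NeZero N] : lapEigenvalue G 0 = 0 := by
  obtain ⟨i, hi⟩ := exists_lapSpectrum_eq_zero G
  refine le_antisymm ?_ ?_
  · rw [← hi]
    refine (G.isHermitian_lapMatrix ℝ).eigenvalues₀_antitone ?_
    rw [Fin.le_def]
    have := ((Fintype.equivOfCardEq (Fintype.card_fin _)).symm i : Fin (Fintype.card (Fin N))).isLt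
    simp only [Fintype.card_fin] at this
    simp [Fin.val_rev]
    omega
  · have := lapSpectrum_nonneg G (Fintype.equivOfCardEq (Fintype.card_fin _)
      (Fin.cast (Fintype.card_fin N).symm (Fin.rev (0 : Fin N))))
    simpa [lapSpectrum, IsHermitian.eigenvalues, lapEigenvalue] using this

theorem sum_lapEigenvalue (f : ℝ → ℝ) :
    ∑ i, f (lapEigenvalue G i) = ∑ i, f (lapSpectrum G i) := by
  unfold lapEigenvalue lapSpectrum IsHermitian.eigenvalues
  rw [Equiv.sum_comp ((Fintype.equivOfCardEq (Fintype.card_fin _)).symm)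
      (fun i => f ((G.isHermitian_lapMatrix ℝ).eigenvalues₀ i)),
    ← Equiv.sum_comp (Fin.revPerm.trans (finCongr (Fintype.card_fin N).symm))
      (fun i => f ((G.isHermitian_lapMatrix ℝ).eigenvalues₀ i))]
  rfl

theorem sum_one_div_lapEigenvalue_sq [NeZero N] :
    ∑ i : Fin N with 1 ≤ i.val, 1 / lapEigenvalue G i ^ 2 = ∑ i, (lapSpectrum G i)⁻¹ ^ 2 := by
  rw [← sum_lapEigenvalue G (fun a => a⁻¹ ^ 2), Finset.sum_filter]
  refine Finset.sum_congr rfl fun i _ => ?_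
  split_ifs with hi
  · simp
  -- The convention `0⁻¹ = 0` makes the extra term `i = 0` vanish.
  · have : i = 0 := Fin.ext (by simpa using hi)
    simp [this, lapEigenvalue_zero]

/-! ### The biharmonic Kirchhoff index -/

theorem transpose_lapPseudoInverse : (lapPseudoInverse G)ᵀ = lapPseudoInverse G := by
  simp [lapPseudoInverse_eq, Matrix.mul_assoc]

theorem trace_lapPseudoInverse_sq :
    (lapPseudoInverse G ^ 2).trace = ∑ i, (lapSpectrum G i)⁻¹ ^ 2 := by
  have h : lapPseudoInverse G ^ 2 = lapEigenvectors G *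
      (diagonal (fun i => (lapSpectrum G i)⁻¹ ^ 2) * (lapEigenvectors G)ᵀ) := by
    rw [pow_two, lapPseudoInverse_eq]
    calc _ = lapEigenvectors G * diagonal (fun i => (lapSpectrum G i)⁻¹) *
          ((lapEigenvectors G)ᵀ * lapEigenvectors G) *
          diagonal (fun i => (lapSpectrum G i)⁻¹) * (lapEigenvectors G)ᵀ := by
            simp only [Matrix.mul_assoc]
      _ = _ := by
        rw [transpose_lapEigenvectors_mul, Matrix.mul_one, Matrix.mul_assoc (lapEigenvectors G),
          diagonal_mul_diagonal, Matrix.mul_assoc]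
        simp only [pow_two]
  rw [h, trace_mul_comm, Matrix.mul_assoc, transpose_lapEigenvectors_mul, Matrix.mul_one,
    trace_diagonal]

theorem lapPseudoInverse_mulVec_one : lapPseudoInverse G *ᵥ (fun _ => 1) = 0 := by
  have h := isPseudoInverse_lapPseudoInverse G
  -- `L` and `L†` are symmetric and so is `L L†`; hence `L L† = L† L`, which moves `L` to the right
  -- where it meets the constants.
  have e : lapPseudoInverse G = lapPseudoInverse G * (lapPseudoInverse G * G.lapMatrix ℝ) := by
    conv_lhs => rw [← h.mul_mul_right, Matrix.mul_assoc, ← h.symm_left, transpose_mul,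
      transpose_lapPseudoInverse, (G.isSymm_lapMatrix (R := ℝ)).eq]
  rw [e, ← mulVec_mulVec, ← mulVec_mulVec, G.lapMatrix_mulVec_const_eq_zero]
  simp

theorem sum_lapPseudoInverse_sq : ∑ j, ∑ k, (lapPseudoInverse G ^ 2) j k = 0 := by
  have h : (lapPseudoInverse G ^ 2) *ᵥ (fun _ => 1) = 0 := by
    rw [pow_two, ← mulVec_mulVec, lapPseudoInverse_mulVec_one, mulVec_zero]
  refine Finset.sum_eq_zero fun j _ => ?_
  simpa [mulVec, dotProduct] using congrFun h j

theorem lapPseudoInverse_sq_symm (j k : Fin N) :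
    (lapPseudoInverse G ^ 2) j k = (lapPseudoInverse G ^ 2) k j := by
  have : (lapPseudoInverse G ^ 2)ᵀ = lapPseudoInverse G ^ 2 := by
    rw [transpose_pow, transpose_lapPseudoInverse]
  exact congrFun (congrFun this k) j

/-- The radicand is the squared Euclidean distance between two rows of `L†`, so `Real.sqrt` does not
truncate it. -/
theorem biharmonicDist_sq (j k : Fin N) :
    biharmonicDist G j k ^ 2 = (lapPseudoInverse G ^ 2) j j + (lapPseudoInverse G ^ 2) k k
      - 2 * (lapPseudoInverse G ^ 2) j k := by
  refine Real.sq_sqrt ?_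
  have hs : ∀ a b, lapPseudoInverse G a b = lapPseudoInverse G b a := fun a b =>
    congrFun (congrFun (transpose_lapPseudoInverse G) b) a
  have : (lapPseudoInverse G ^ 2) j j + (lapPseudoInverse G ^ 2) k k
      - 2 * (lapPseudoInverse G ^ 2) j k
      = ∑ m, (lapPseudoInverse G j m - lapPseudoInverse G k m) ^ 2 := by
    simp only [pow_two (lapPseudoInverse G), Matrix.mul_apply, Finset.mul_sum,
      ← Finset.sum_add_distrib, ← Finset.sum_sub_distrib]
    refine Finset.sum_congr rfl fun m _ => ?_
    rw [hs m j, hs m k]; ring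
  rw [this]
  positivity

theorem biharmonicKirchhoffIndex_eq :
    biharmonicKirchhoffIndex G = N * ∑ i, (lapSpectrum G i)⁻¹ ^ 2 := by
  set M := lapPseudoInverse G ^ 2 with hM
  let f : Fin N → Fin N → ℝ := fun j k => M j j + M k k - 2 * M j k
  have hfs : ∀ j k, f j k = f k j := fun j k => by
    simp only [f, hM, lapPseudoInverse_sq_symm G j k]; ring
  have hf0 : ∀ j, f j j = 0 := fun j => by simp only [f]; ring
  have hK : biharmonicKirchhoffIndex G = ∑ j, ∑ k, if j < k then f j k else 0 := by
    unfold biharmonicKirchhoffIndex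
    rw [Finset.sum_filter, Fintype.sum_prod_type]
    simp only [biharmonicDist_sq]
    rfl
  have hK' : biharmonicKirchhoffIndex G = ∑ j, ∑ k, if k < j then f j k else 0 := by
    rw [hK, Finset.sum_comm]
    exact Finset.sum_congr rfl fun j _ => Finset.sum_congr rfl fun k _ => by rw [hfs]
  -- The summand is symmetric and zero on the diagonal, so the full double sum counts each pair
  -- twice.
  have htot : biharmonicKirchhoffIndex G + biharmonicKirchhoffIndex G = ∑ j, ∑ k, f j k := by
    conv_lhs => enter [2]; rw [hK']
    rw [hK, ← Finset.sum_add_distrib]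
    refine Finset.sum_congr rfl fun j _ => ?_
    rw [← Finset.sum_add_distrib]
    refine Finset.sum_congr rfl fun k _ => ?_
    rcases lt_trichotomy j k with h | h | h
    · simp [h, h.not_gt]
    · subst h; simp [hf0]
    · simp [h, h.not_gt]
  have hsum : ∑ j, ∑ k, f j k = 2 * (N * M.trace) := by
    simp only [f, Finset.sum_sub_distrib, Finset.sum_add_distrib, ← Finset.mul_sum, hM,
      sum_lapPseudoInverse_sq]
    simp only [trace, diag_apply, Finset.sum_const, Finset.card_univ, Fintype.card_fin,
      nsmul_eq_mul]
    rw [← Finset.mul_sum]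
    ring
  rw [← trace_lapPseudoInverse_sq]
  linarith

/-! ### Deviations from the average in the eigenbasis -/

theorem lapEigenvectors_const (hG : G.Connected) {i : Fin N} (hi : lapSpectrum G i = 0)
    (j k : Fin N) : lapEigenvectors G j i = lapEigenvectors G k i := by
  have h := lapMatrix_mulVec_lapEigenvectors G i
  rw [hi, zero_smul, G.lapMatrix_mulVec_eq_zero_iff_forall_reachable] at h
  exact h j k (hG.preconnected j k)

/-- Centering is the orthogonal projection off the constants, which are the whole kernel of `L`. -/
theorem transpose_lapEigenvectors_mulVec_sub_average [NeZero N] (hG : G.Connected)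
    (w : Fin N → ℝ) (i : Fin N) :
    ((lapEigenvectors G)ᵀ *ᵥ fun j => w j - 1 / (N : ℝ) * ∑ k, w k) i
      = if lapSpectrum G i = 0 then 0 else ((lapEigenvectors G)ᵀ *ᵥ w) i := by
  simp only [mulVec, dotProduct, transpose_apply, mul_sub, Finset.sum_sub_distrib,
    ← Finset.sum_mul]
  split_ifs with hi
  · simp only [fun j => lapEigenvectors_const G hG hi j 0, ← Finset.mul_sum]
    have : (N : ℝ) ≠ 0 := NeZero.ne _
    simp
    field_simp
    ring
  · rw [transpose_lapEigenvectors_mulVec_one G hi]; simp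

theorem sub_average_eq [NeZero N] (hG : G.Connected) (w : Fin N → ℝ) (j : Fin N) :
    w j - 1 / (N : ℝ) * ∑ k, w k = ∑ i, lapEigenvectors G j i *
      if lapSpectrum G i = 0 then 0 else ((lapEigenvectors G)ᵀ *ᵥ w) i := by
  have h : lapEigenvectors G *ᵥ ((lapEigenvectors G)ᵀ *ᵥ fun j => w j - 1 / (N : ℝ) * ∑ k, w k)
      = fun j => w j - 1 / (N : ℝ) * ∑ k, w k := by
    rw [mulVec_mulVec, lapEigenvectors_mul_transpose, one_mulVec]
  rw [← congrFun h j]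
  simp only [← transpose_lapEigenvectors_mulVec_sub_average G hG]
  rfl

theorem sum_sub_average_sq [NeZero N] (hG : G.Connected) (w : Fin N → ℝ) :
    ∑ j, (w j - 1 / (N : ℝ) * ∑ k, w k) ^ 2
      = ∑ i, if lapSpectrum G i = 0 then 0 else ((lapEigenvectors G)ᵀ *ᵥ w) i ^ 2 := by
  set d : Fin N → ℝ := fun j => w j - 1 / (N : ℝ) * ∑ k, w k with hd
  have h : d ⬝ᵥ d = ((lapEigenvectors G)ᵀ *ᵥ d) ⬝ᵥ ((lapEigenvectors G)ᵀ *ᵥ d) := by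
    rw [dotProduct_mulVec, vecMul_transpose, mulVec_mulVec, lapEigenvectors_mul_transpose,
      one_mulVec]
  have h1 : ∑ j, (w j - 1 / (N : ℝ) * ∑ k, w k) ^ 2 = d ⬝ᵥ d := by
    simp [dotProduct, hd, pow_two]
  rw [h1, h]
  refine Finset.sum_congr rfl fun i _ => ?_
  rw [hd, transpose_lapEigenvectors_mulVec_sub_average G hG]
  split_ifs <;> ring

end Spectrum

/-! ### Decoupling the dynamics into modes -/

section Modes

variable {N : ℕ} (G : SimpleGraph (Fin N)) [DecidableRel G.Adj]

/-- The coordinate of the positions along the `i`-th Laplacian eigenvector. -/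
noncomputable def modePosition (i : Fin N) : (Fin N ⊕ Fin N → ℝ) →L[ℝ] ℝ :=
  ∑ j, lapEigenvectors G j i • ContinuousLinearMap.proj (Sum.inl j)

/-- The coordinate of the velocities along the `i`-th Laplacian eigenvector. -/
noncomputable def modeVelocity (i : Fin N) : (Fin N ⊕ Fin N → ℝ) →L[ℝ] ℝ :=
  ∑ j, lapEigenvectors G j i • ContinuousLinearMap.proj (Sum.inr j)

theorem modePosition_apply (i : Fin N) (v : Fin N ⊕ Fin N → ℝ) :
    modePosition G i v = ((lapEigenvectors G)ᵀ *ᵥ (v ∘ Sum.inl)) i := by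
  simp [modePosition, mulVec, dotProduct]

theorem modeVelocity_apply (i : Fin N) (v : Fin N ⊕ Fin N → ℝ) :
    modeVelocity G i v = ((lapEigenvectors G)ᵀ *ᵥ (v ∘ Sum.inr)) i := by
  simp [modeVelocity, mulVec, dotProduct]

theorem modePosition_systemMatrix (i : Fin N) (v : Fin N ⊕ Fin N → ℝ) :
    modePosition G i (systemMatrix G *ᵥ v) = modeVelocity G i v := by
  rw [modePosition_apply, modeVelocity_apply, systemMatrix, fromBlocks_mulVec]
  simp

theorem modeVelocity_systemMatrix (i : Fin N) (v : Fin N ⊕ Fin N → ℝ) :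
    modeVelocity G i (systemMatrix G *ᵥ v)
      = -(lapSpectrum G i * modePosition G i v) - lapSpectrum G i * modeVelocity G i v := by
  rw [modeVelocity_apply, modeVelocity_apply, modePosition_apply, systemMatrix, fromBlocks_mulVec,
    Sum.elim_comp_inr, neg_mulVec, neg_mulVec, mulVec_add, mulVec_neg, mulVec_neg, Pi.add_apply,
    Pi.neg_apply, Pi.neg_apply, transpose_lapEigenvectors_mulVec_lapMatrix,
    transpose_lapEigenvectors_mulVec_lapMatrix, sub_eq_add_neg]

theorem modePosition_inputMatrix (i : Fin N) (w : Fin N → ℝ) :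
    modePosition G i (inputMatrix N *ᵥ w) = 0 := by
  rw [modePosition_apply, inputMatrix, fromRows_mulVec]
  simp

theorem modeVelocity_inputMatrix (i : Fin N) (w : Fin N → ℝ) :
    modeVelocity G i (inputMatrix N *ᵥ w) = ∑ j, lapEigenvectors G j i * w j := by
  rw [modeVelocity_apply, inputMatrix, fromRows_mulVec]
  simp [mulVec, dotProduct]

variable {Ω : Type*} [MeasurableSpace Ω] {P : Measure Ω} [IsProbabilityMeasure P]
  {W : ℝ≥0 → Ω → Fin N → ℝ} {x : ℝ≥0 → Ω → Fin N ⊕ Fin N → ℝ}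

theorem tendsto_integral_modePosition_sq (hW : IsStandardBrownianMotion W P)
    (hx : IsSolution G W x P) (hx0 : ∀ a, MemLp (fun ω => x 0 ω a) 2 P) {i : Fin N}
    (hi : lapSpectrum G i ≠ 0) :
    (∀ t, MemLp (fun ω => modePosition G i (x t ω)) 2 P) ∧
      Tendsto (fun t => ∫ ω, modePosition G i (x t ω) ^ 2 ∂P) atTop
        (𝓝 (1 / 2 * (lapSpectrum G i)⁻¹ ^ 2)) := by
  obtain ⟨hbL, hcov⟩ := hW.memLp_and_covariance_projection (sum_lapEigenvectors_sq G i)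
  have hAx : ∀ ω, (Continuous fun t => x t ω) →
      Continuous fun s : ℝ => systemMatrix G *ᵥ x s.toNNReal ω := fun ω h =>
    continuous_const.matrix_mulVec (h.comp continuous_real_toNNReal)
  -- A continuous linear functional passes through the pathwise integral equation; the two mode
  -- coordinates then satisfy a closed scalar system.
  have hproj : ∀ ℓ : (Fin N ⊕ Fin N → ℝ) →L[ℝ] ℝ, ∀ᵐ ω ∂P, ∀ t : ℝ≥0,
      ℓ (x t ω) = ℓ (x 0 ω) + (∫ s in (0 : ℝ)..t, ℓ (systemMatrix G *ᵥ x s.toNNReal ω))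
        + ℓ (inputMatrix N *ᵥ W t ω) := by
    intro ℓ
    filter_upwards [hx.continuous_path, hx.integral_eq] with ω h1 h2 t
    conv_lhs => rw [h2 t]
    rw [map_add, map_add, ℓ.intervalIntegral_comp_comm ((hAx ω h1).intervalIntegrable _ _)]
  have hb : ∀ᵐ ω ∂P, Continuous fun t => ∑ j, lapEigenvectors G j i * W t ω j := by
    filter_upwards [ae_all_iff.2 fun j => (hW.isBrownianReal j).cont] with ω h
    exact continuous_finsetSum _ fun j _ => continuous_const.mul (h j)
  refine tendsto_integral_sq_oscillator ((lapSpectrum_nonneg G i).lt_of_ne' hi)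
    (z := fun t ω => modeVelocity G i (x t ω))
    (b := fun t ω => ∑ j, lapEigenvectors G j i * W t ω j)
    (hx.continuous_path.mono fun ω h => (modePosition G i).continuous.comp h)
    (hx.continuous_path.mono fun ω h => (modeVelocity G i).continuous.comp h) hb
    ?_ ?_ ?_ ?_ hbL hcov
  · simpa only [modePosition_systemMatrix, modePosition_inputMatrix, add_zero] using
      hproj (modePosition G i)
  · simpa only [modeVelocity_systemMatrix, modeVelocity_inputMatrix] using
      hproj (modeVelocity G i)
  · simp only [modePosition_apply, mulVec, dotProduct]
    exact memLp_finsetSum _ fun j _ => (hx0 (Sum.inl j)).const_mul _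
  · simp only [modeVelocity_apply, mulVec, dotProduct]
    exact memLp_finsetSum _ fun j _ => (hx0 (Sum.inr j)).const_mul _

theorem memLp_deviation [NeZero N] (hG : G.Connected) (hW : IsStandardBrownianMotion W P)
    (hx : IsSolution G W x P) (hx0 : ∀ a, MemLp (fun ω => x 0 ω a) 2 P) (j : Fin N) (t : ℝ≥0) :
    MemLp (deviation x j t) 2 P := by
  have e : deviation x j t = fun ω => ∑ i, lapEigenvectors G j i *
      if lapSpectrum G i = 0 then 0 else modePosition G i (x t ω) := by
    ext ω
    simp only [modePosition_apply]
    exact sub_average_eq G hG (x t ω ∘ Sum.inl) j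
  rw [e]
  refine memLp_finsetSum _ fun i _ => MemLp.const_mul ?_ _
  split_ifs with hi
  · exact MemLp.zero'
  · exact (tendsto_integral_modePosition_sq G hW hx hx0 hi).1 t

theorem hasTotalVariance [NeZero N] (hG : G.Connected) (hW : IsStandardBrownianMotion W P)
    (hx : IsSolution G W x P) (hx0 : ∀ a, MemLp (fun ω => x 0 ω a) 2 P) :
    HasTotalVariance x P (1 / 2 * ∑ i, (lapSpectrum G i)⁻¹ ^ 2) := by
  have hdev := memLp_deviation G hG hW hx hx0
  refine ⟨fun t j => (hdev j t).integrable_sq, ?_⟩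
  -- Parseval holds for each `ω`, so taking expectations produces no cross terms between modes.
  have e : ∀ t, ∑ j, ∫ ω, deviation x j t ω ^ 2 ∂P
      = ∑ i, if lapSpectrum G i = 0 then 0 else ∫ ω, modePosition G i (x t ω) ^ 2 ∂P := by
    intro t
    rw [← integral_finsetSum _ fun j _ => (hdev j t).integrable_sq]
    have h : ∀ ω, ∑ j, deviation x j t ω ^ 2
        = ∑ i, if lapSpectrum G i = 0 then 0 else modePosition G i (x t ω) ^ 2 := fun ω => by
      simp only [modePosition_apply]
      exact sum_sub_average_sq G hG (x t ω ∘ Sum.inl)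
    simp only [h]
    rw [integral_finsetSum]
    · refine Finset.sum_congr rfl fun i _ => ?_
      split_ifs <;> simp
    · intro i _
      split_ifs with hi
      · exact integrable_zero _ _ _
      · exact ((tendsto_integral_modePosition_sq G hW hx hx0 hi).1 t).integrable_sq
  simp_rw [e, Finset.mul_sum]
  refine tendsto_finsetSum _ fun i _ => ?_
  split_ifs with hi
  · simp [hi]
  · exact (tendsto_integral_modePosition_sq G hW hx hx0 hi).2

end Modes

end SecondOrderConsensus

theorem mainTheorem3 {N : ℕ} (G : SimpleGraph (Fin N)) [DecidableRel G.Adj] (hG : G.Connected)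
    {Ω : Type*} [MeasurableSpace Ω] (P : Measure Ω) [IsProbabilityMeasure P]
    (W : ℝ≥0 → Ω → Fin N → ℝ) (hW : SecondOrderConsensus.IsStandardBrownianMotion W P)
    (x : ℝ≥0 → Ω → Fin N ⊕ Fin N → ℝ) (hx : SecondOrderConsensus.IsSolution G W x P)
    (hx0 : ∀ a, MemLp (fun ω => x 0 ω a) 2 P) :
    SecondOrderConsensus.HasTotalVariance x P
        (SecondOrderConsensus.biharmonicKirchhoffIndex G / (2 * (N : ℝ))) ∧
      SecondOrderConsensus.biharmonicKirchhoffIndex G / (2 * (N : ℝ)) =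
        1 / 2 * ∑ i : Fin N with 1 ≤ i.val, 1 / SecondOrderConsensus.lapEigenvalue G i ^ 2 := by
  have : NeZero N := ⟨by
    rintro rfl
    exact hG.nonempty.elim fun i => i.elim0⟩
  have hN : (N : ℝ) ≠ 0 := NeZero.ne _
  have hindex : SecondOrderConsensus.biharmonicKirchhoffIndex G / (2 * (N : ℝ))
      = 1 / 2 * ∑ i, (SecondOrderConsensus.lapSpectrum G i)⁻¹ ^ 2 := by
    rw [SecondOrderConsensus.biharmonicKirchhoffIndex_eq]
    field_simp
  rw [SecondOrderConsensus.sum_one_div_lapEigenvalue_sq, hindex]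
  exact ⟨SecondOrderConsensus.hasTotalVariance G hG hW hx hx0, rfl⟩
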